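/- For $\tau$ in the upper half-plane $\mathfrak H=\{z\in\mathbb C:\operatorname{Im} z>0\}$ and $r\in\mathbb R$ write $q^r:=e^{2\pi i r\tau}$, and let $$j(\tau):=\frac{E_4(\tau)^3}{\eta(\tau)^{24}},\qquad E_4(\tau):=1+240\sum_{n=1}^{\infty}\Big(\sum_{d\mid n}d^3\Big)q^n,\qquad \eta(\tau):=q^{1/24}\prod_{n=1}^{\infty}(1-q^n).$$ Define Jacobi's theta functions by $$\theta_0(\tau):=\sum_{n\in\mathbb Z}(-1)^nq^{n^2/2},\qquad \theta_2(\tau):=\sum_{n\in\mathbb Z}q^{\frac12\left(n+\frac12\right)^2},\qquad \theta_3(\tau):=\sum_{n\in\mathbb Z}q^{n^2/2}.$$ Then for every $\tau\in\mathfrak H$ these series and the following infinite products converge, $$\theta_0(\tau)=\prod_{n=1}^{\infty}(1-q^n)(1-q^{n-\frac12})^2,\qquad \theta_2(\tau)=2q^{1/8}\prod_{n=1}^{\infty}(1-q^n)(1+q^n)^2,\qquad \theta_3(\tau)=\prod_{n=1}^{\infty}(1-q^n)(1+q^{n-\frac12})^2,$$ the three values $\theta_0(\tau),\theta_2(\tau),\theta_3(\tau)$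 are nonzero, and $$j(\tau)=2^7\big(\theta_0(\tau)^8+\theta_2(\tau)^8+\theta_3(\tau)^8\big)\big(\theta_0(\tau)^{-8}+\theta_2(\tau)^{-8}+\theta_3(\tau)^{-8}\big).$$ -/

import Mathlib

noncomputable section

namespace JTheta

open Complex

/-- The fractional power `q ^ r := exp (2 π i r τ)` of `q = exp (2 π i τ)`. -/
def qPow (τ : UpperHalfPlane) (r : ℝ) : ℂ := cexp (2 * Real.pi * I * r * τ)

/-- The Eisenstein series `E₄(τ) = 1 + 240 ∑_{n ≥ 1} σ₃(n) q ^ n`. -/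
def E4 (τ : UpperHalfPlane) : ℂ :=
  1 + 240 * ∑' n : ℕ+, (ArithmeticFunction.sigma 3 (n : ℕ) : ℂ) * qPow τ ((n : ℕ) : ℝ)

/-- The elliptic modular function `j(τ) = E₄(τ) ^ 3 / η(τ) ^ 24`, with the Dedekind eta function
`η(τ) = q ^ (1 / 24) ∏_{n ≥ 1} (1 - q ^ n)`. -/
def j (τ : UpperHalfPlane) : ℂ := E4 τ ^ 3 / ModularForm.eta (τ : ℂ) ^ 24

/-- The `n`-th term `(-1) ^ n q ^ (n ^ 2 / 2)` of the series for `θ₀`. -/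
def theta0Term (τ : UpperHalfPlane) (n : ℤ) : ℂ := (-1 : ℂ) ^ n * qPow τ ((n : ℝ) ^ 2 / 2)

/-- The `n`-th term `q ^ ((n + 1 / 2) ^ 2 / 2)` of the series for `θ₂`. -/
def theta2Term (τ : UpperHalfPlane) (n : ℤ) : ℂ := qPow τ (1 / 2 * ((n : ℝ) + 1 / 2) ^ 2)

/-- The `n`-th term `q ^ (n ^ 2 / 2)` of the series for `θ₃`. -/
def theta3Term (τ : UpperHalfPlane) (n : ℤ) : ℂ := qPow τ ((n : ℝ) ^ 2 / 2)

/-- Jacobi's theta function `θ₀(τ) = ∑_{n ∈ ℤ} (-1) ^ n q ^ (n ^ 2 / 2)`. -/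
def theta0 (τ : UpperHalfPlane) : ℂ := ∑' n : ℤ, theta0Term τ n

/-- Jacobi's theta function `θ₂(τ) = ∑_{n ∈ ℤ} q ^ ((n + 1 / 2) ^ 2 / 2)`. -/
def theta2 (τ : UpperHalfPlane) : ℂ := ∑' n : ℤ, theta2Term τ n

/-- Jacobi's theta function `θ₃(τ) = ∑_{n ∈ ℤ} q ^ (n ^ 2 / 2)`. -/
def theta3 (τ : UpperHalfPlane) : ℂ := ∑' n : ℤ, theta3Term τ n

/-- The factor with index `n + 1` of the product for `θ₀`:
`(1 - q ^ m) (1 - q ^ (m - 1 / 2)) ^ 2` at `m = n + 1`. -/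
def theta0Factor (τ : UpperHalfPlane) (n : ℕ) : ℂ :=
  (1 - qPow τ ((n : ℝ) + 1)) * (1 - qPow τ ((n : ℝ) + 1 - 1 / 2)) ^ 2

/-- The factor with index `n + 1` of the product for `θ₂`:
`(1 - q ^ m) (1 + q ^ m) ^ 2` at `m = n + 1`. -/
def theta2Factor (τ : UpperHalfPlane) (n : ℕ) : ℂ :=
  (1 - qPow τ ((n : ℝ) + 1)) * (1 + qPow τ ((n : ℝ) + 1)) ^ 2

/-- The factor with index `n + 1` of the product for `θ₃`:
`(1 - q ^ m) (1 + q ^ (m - 1 / 2)) ^ 2` at `m = n + 1`. -/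
def theta3Factor (τ : UpperHalfPlane) (n : ℕ) : ℂ :=
  (1 - qPow τ ((n : ℝ) + 1)) * (1 + qPow τ ((n : ℝ) + 1 - 1 / 2)) ^ 2

/-- The series defining `E4` converges. -/
theorem summable_E4 (τ : UpperHalfPlane) :
    Summable fun n : ℕ+ =>
      (ArithmeticFunction.sigma 3 (n : ℕ) : ℂ) * qPow τ ((n : ℕ) : ℝ) := by
  have h := (EisensteinSeries.summable_sigma_mul_cexp_pow (k := 4) (by norm_num) τ).comp_injective
    PNat.coe_injective
  refine h.congr fun n => ?_
  simp only [Function.comp_apply, qPow, ← Complex.exp_nat_mul]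
  congr 2
  push_cast
  ring

end JTheta

end

/-! ### The Jacobi triple product and Euler's product identity. -/

noncomputable section

namespace JTheta

open Complex Filter Topology Finset

/-! The product formulas are the Jacobi triple product at `z = -1`, `z = q ^ (1 / 2)` and `z = 1`.
The triple product itself is the limit of a finite identity (`hasSum_tripleCoeff`), proved by
induction from a recurrence for its coefficients. Multiplying the three products and using Euler's
identity gives `θ₀ θ₂ θ₃ = 2 η ^ 3` (`theta_mul_eq_eta`), so no theta value vanishes and `η ^ 24` is
expressed through them.

The remaining identities come from modularity. Up to automorphy factors and signs, `S` and `T`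
permute the fourth powers of the thetas, so suitable polynomials in them are modular of level one
and weight 4. One that vanishes at `i ∞` is a cusp form of weight below 12, hence zero
(`eq_zero_of_invariant`). This yields `θ₃ ^ 4 = θ₀ ^ 4 + θ₂ ^ 4` and `2 E₄ = s`, where `s = θ₀ ^ 8 +
θ₂ ^ 8 + θ₃ ^ 8`. Then `j = 32 s ^ 3 / (θ₀ θ₂ θ₃) ^ 8`, and the quartic identity turns `s ^ 2` into
four times the second elementary symmetric function of the eighth powers, which is the claim. -/

/-- The finite `q`-Pochhammer symbol `∏_{i < k} (1 - Q ^ (i + 1))`. -/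
def qPoch (Q : ℂ) (k : ℕ) : ℂ := ∏ i ∈ range k, (1 - Q ^ (i + 1))

/-- The reciprocal of the `q`-Pochhammer symbol, extended by zero to negative indices. -/
def qPochInv (Q : ℂ) (k : ℤ) : ℂ := if 0 ≤ k then (qPoch Q k.toNat)⁻¹ else 0

lemma one_sub_pow_ne_zero {Q : ℂ} (hQ : ‖Q‖ < 1) (n : ℕ) : 1 - Q ^ (n + 1) ≠ 0 := by
  intro h
  have h1 : ‖Q ^ (n + 1)‖ < 1 := by
    rw [norm_pow]; exact pow_lt_one₀ (norm_nonneg _) hQ (by omega)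
  rw [← sub_eq_zero.mp h] at h1
  simp at h1

/-- The extension by zero is consistent with the recurrence because `1 - Q ^ 0 = 0`; no boundary
cases are then needed for the coefficients. -/
lemma qPochInv_sub_one {Q : ℂ} (hQ : ‖Q‖ < 1) (k : ℤ) :
    qPochInv Q (k - 1) = (1 - Q ^ k) * qPochInv Q k := by
  rcases lt_trichotomy k 0 with h | rfl | h
  · rw [qPochInv, qPochInv, if_neg (by omega), if_neg (by omega), mul_zero]
  · simp [qPochInv]
  · obtain ⟨m, rfl⟩ : ∃ m : ℕ, k = m + 1 := ⟨(k - 1).toNat, by omega⟩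
    have h1 : ((m : ℤ) + 1).toNat = m + 1 := by omega
    have h2 : Q ^ ((m : ℤ) + 1) = Q ^ (m + 1) := by exact_mod_cast zpow_natCast Q (m + 1)
    simp only [qPochInv, add_sub_cancel_right, Nat.cast_nonneg, if_true, Int.toNat_natCast, h1,
      h2, show (0 : ℤ) ≤ m + 1 by omega]
    rw [qPoch, qPoch, prod_range_succ, mul_inv]
    field_simp [one_sub_pow_ne_zero hQ m]

/-- The coefficients of the finite form of the triple product. -/
def tripleCoeff (Q : ℂ) (N : ℕ) (n : ℤ) : ℂ :=
  qPoch Q (2 * N) * (qPochInv Q (N - n) * qPochInv Q (N + n))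

/-- This is what multiplication by `(1 + p ^ (2N+1) z) (1 + p ^ (2N+1) z⁻¹)`, `Q = p ^ 2`, does to
the coefficients. Writing everything through `qPochInv` at `N + 1 - n` and `N + 1 + n` leaves a
rational identity. -/
lemma tripleCoeff_succ {Q : ℂ} (hQ : ‖Q‖ < 1) (hQ0 : Q ≠ 0) (N : ℕ) (n : ℤ) :
    tripleCoeff Q (N + 1) n = (1 + Q ^ (2 * N + 1)) * tripleCoeff Q N n +
      Q ^ ((N : ℤ) + 1 - n) * tripleCoeff Q N (n - 1) +
      Q ^ ((N : ℤ) + 1 + n) * tripleCoeff Q N (n + 1) := by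
  have a1 := qPochInv_sub_one hQ ((N : ℤ) + 1 - n)
  have a2 := qPochInv_sub_one hQ ((N : ℤ) - n)
  have b1 := qPochInv_sub_one hQ ((N : ℤ) + 1 + n)
  have b2 := qPochInv_sub_one hQ ((N : ℤ) + n)
  have e1 : (N : ℤ) + 1 - n - 1 = N - n := by ring
  have e2 : (N : ℤ) + 1 + n - 1 = N + n := by ring
  rw [e1] at a1
  rw [e2] at b1
  have u1 : Q ^ ((N : ℤ) - n) = Q ^ ((N : ℤ) + 1 - n) / Q := by
    rw [← e1, zpow_sub_one₀ hQ0, div_eq_mul_inv]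
  have v1 : Q ^ ((N : ℤ) + n) = Q ^ ((N : ℤ) + 1 + n) / Q := by
    rw [← e2, zpow_sub_one₀ hQ0, div_eq_mul_inv]
  have w : Q ^ (2 * N + 2) = Q ^ ((N : ℤ) + 1 - n) * Q ^ ((N : ℤ) + 1 + n) := by
    rw [← zpow_add₀ hQ0, ← zpow_natCast]; congr 1; push_cast; ring
  have w' : Q ^ (2 * N + 1) = Q ^ ((N : ℤ) + 1 - n) * Q ^ ((N : ℤ) + 1 + n) / Q := by
    rw [← w, pow_succ Q (2 * N + 1)]; field_simp
  have hE : qPoch Q (2 * (N + 1)) =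
      qPoch Q (2 * N) * (1 - Q ^ (2 * N + 1)) * (1 - Q ^ (2 * N + 2)) := by
    rw [qPoch, qPoch, show 2 * (N + 1) = 2 * N + 1 + 1 by ring, prod_range_succ, prod_range_succ]
  have i1 : (N : ℤ) - (n - 1) = N + 1 - n := by ring
  have i2 : (N : ℤ) + (n - 1) = N + n - 1 := by ring
  have i3 : (N : ℤ) - (n + 1) = N - n - 1 := by ring
  have i4 : (N : ℤ) + (n + 1) = N + 1 + n := by ring
  have i5 : ((N + 1 : ℕ) : ℤ) = N + 1 := by push_cast; ring
  simp only [tripleCoeff, i1, i2, i3, i4, i5]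
  rw [a2, b2, a1, b1, hE, u1, v1, w, w']
  field_simp
  ring

lemma tripleCoeff_zero (Q : ℂ) (n : ℤ) : tripleCoeff Q 0 n = if n = 0 then 1 else 0 := by
  rcases lt_trichotomy n 0 with h | rfl | h
  · simp [tripleCoeff, qPochInv, show ¬ (0 ≤ n) by omega, h.ne]
  · simp [tripleCoeff, qPochInv, qPoch]
  · simp [tripleCoeff, qPochInv, show ¬ (n ≤ 0) by omega, h.ne']

/-- The finite form of the Jacobi triple product. -/
lemma hasSum_tripleCoeff {p z : ℂ} (hp : ‖p‖ < 1) (hp0 : p ≠ 0) (hz : z ≠ 0) (N : ℕ) :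
    HasSum (fun n : ℤ => tripleCoeff (p ^ 2) N n * (p ^ (n ^ 2) * z ^ n))
      (∏ m ∈ range N, (1 + p ^ (2 * m + 1) * z) * (1 + p ^ (2 * m + 1) * z⁻¹)) := by
  have hQ : ‖p ^ 2‖ < 1 := by
    rw [norm_pow]; exact pow_lt_one₀ (norm_nonneg _) hp (by norm_num)
  have hQ0 : p ^ 2 ≠ 0 := pow_ne_zero _ hp0
  induction N with
  | zero =>
    simp only [tripleCoeff_zero, range_zero, prod_empty]
    convert hasSum_ite_eq (0 : ℤ) (1 : ℂ) using 2 with n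
    split_ifs with h <;> simp [h]
  | succ N ih =>
    have h1 := ih.mul_left (1 + (p ^ 2) ^ (2 * N + 1))
    have h2 := ((Equiv.subRight (1 : ℤ)).hasSum_iff.mpr ih).mul_left (p ^ (2 * N + 1) * z)
    have h3 := ((Equiv.addRight (1 : ℤ)).hasSum_iff.mpr ih).mul_left (p ^ (2 * N + 1) * z⁻¹)
    have h4 := (h1.add h2).add h3
    rw [prod_range_succ]
    convert! h4 using 1
    · funext n
      have k1 : (p ^ 2) ^ ((N : ℤ) + 1 - n) * (p ^ (n ^ 2) * z ^ n) =
          (p ^ (2 * N + 1) * z) * (p ^ ((n - 1) ^ 2) * z ^ (n - 1)) := by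
        rw [← zpow_natCast p 2, ← zpow_mul, zpow_sub_one₀ hz, ← zpow_natCast p (2 * N + 1)]
        have : p ^ (((2 : ℕ) : ℤ) * ((N : ℤ) + 1 - n)) * p ^ (n ^ 2) =
          p ^ ((2 * N + 1 : ℕ) : ℤ) * p ^ ((n - 1) ^ 2) := by
          rw [← zpow_add₀ hp0, ← zpow_add₀ hp0]; congr 1; push_cast; ring
        rw [← mul_assoc, this]; field_simp
      have k2 : (p ^ 2) ^ ((N : ℤ) + 1 + n) * (p ^ (n ^ 2) * z ^ n) =
          (p ^ (2 * N + 1) * z⁻¹) * (p ^ ((n + 1) ^ 2) * z ^ (n + 1)) := by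
        rw [← zpow_natCast p 2, ← zpow_mul, zpow_add_one₀ hz, ← zpow_natCast p (2 * N + 1)]
        have : p ^ (((2 : ℕ) : ℤ) * ((N : ℤ) + 1 + n)) * p ^ (n ^ 2) =
          p ^ ((2 * N + 1 : ℕ) : ℤ) * p ^ ((n + 1) ^ 2) := by
          rw [← zpow_add₀ hp0, ← zpow_add₀ hp0]; congr 1; push_cast; ring
        rw [← mul_assoc, this]; field_simp
      simp only [Function.comp, Equiv.subRight_apply, Equiv.coe_addRight]
      rw [tripleCoeff_succ hQ hQ0]
      linear_combination tripleCoeff (p ^ 2) N (n - 1) * k1 + tripleCoeff (p ^ 2) N (n + 1) * k2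
    · have h5 : p ^ (2 * N + 1) * z * (p ^ (2 * N + 1) * z⁻¹) = (p ^ 2) ^ (2 * N + 1) := by
        field_simp
        ring
      linear_combination (∏ m ∈ range N, (1 + p ^ (2 * m + 1) * z) *
        (1 + p ^ (2 * m + 1) * z⁻¹)) * h5

lemma multipliable_one_add_mul_pow {p : ℂ} (hp : ‖p‖ < 1) (c : ℂ) {f : ℕ → ℕ}
    (hf : Function.Injective f) : Multipliable fun m : ℕ => 1 + c * p ^ f m := by
  apply multipliable_one_add_of_summable
  simp only [norm_mul, norm_pow]
  exact ((summable_geometric_of_lt_one (norm_nonneg _) hp).comp_injective hf).mul_left _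

lemma tendsto_qPoch {Q : ℂ} (hQ : ‖Q‖ < 1) :
    Tendsto (qPoch Q) atTop (𝓝 (∏' m : ℕ, (1 - Q ^ (m + 1)))) :=
  (ModularForm.multipliable_one_sub_pow hQ).tendsto_prod_tprod_nat

lemma tprod_one_sub_pow_ne_zero {Q : ℂ} (hQ : ‖Q‖ < 1) :
    ∏' m : ℕ, (1 - Q ^ (m + 1)) ≠ 0 := by
  simp only [sub_eq_add_neg]
  refine tprod_one_add_ne_zero_of_summable (f := fun n : ℕ => -Q ^ (n + 1)) (fun i => ?_) ?_
  · simpa [sub_eq_add_neg] using one_sub_pow_ne_zero hQ i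
  · simpa using (summable_nat_add_iff 1).mpr (summable_geometric_of_lt_one (norm_nonneg _) hQ)

lemma tendsto_tripleCoeff {Q : ℂ} (hQ : ‖Q‖ < 1) (n : ℤ) :
    Tendsto (fun N => tripleCoeff Q N n) atTop (𝓝 (∏' m : ℕ, (1 - Q ^ (m + 1)))⁻¹) := by
  have h0 := tprod_one_sub_pow_ne_zero hQ
  have hE := tendsto_qPoch hQ
  have key : ∀ s : ℤ, Tendsto (fun N : ℕ => qPochInv Q (N + s)) atTop
      (𝓝 (∏' m : ℕ, (1 - Q ^ (m + 1)))⁻¹) := by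
    intro s
    have ht : Tendsto (fun N : ℕ => ((N : ℤ) + s).toNat) atTop atTop := by
      refine tendsto_atTop.mpr fun b => ?_
      filter_upwards [eventually_ge_atTop (b + s.natAbs)] with N hN
      omega
    refine ((hE.comp ht).inv₀ h0).congr' ?_
    filter_upwards [eventually_ge_atTop s.natAbs] with N hN
    simp [qPochInv, show 0 ≤ (N : ℤ) + s by omega]
  have h2 : Tendsto (fun N : ℕ => 2 * N) atTop atTop := tendsto_id.const_mul_atTop' two_pos
  have := (hE.comp h2).mul ((key (-n)).mul (key n))
  rw [mul_inv_cancel_left₀ h0] at this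
  simpa [tripleCoeff, sub_eq_add_neg] using this

/-- Uniformity in both `N` and `n` supplies the dominating series for the passage to the limit in
the finite triple product. -/
lemma exists_norm_tripleCoeff_le {Q : ℂ} (hQ : ‖Q‖ < 1) :
    ∃ C : ℝ, ∀ N n, ‖tripleCoeff Q N n‖ ≤ C := by
  have h0 := tprod_one_sub_pow_ne_zero hQ
  have hE := tendsto_qPoch hQ
  obtain ⟨A, hA⟩ := hE.norm.bddAbove_range
  obtain ⟨B, hB⟩ := (hE.inv₀ h0).norm.bddAbove_range
  have hA' : ∀ k, ‖qPoch Q k‖ ≤ A := fun k => hA ⟨k, rfl⟩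
  have hB' : ∀ k : ℕ, ‖(qPoch Q k)⁻¹‖ ≤ B := fun k => hB ⟨k, rfl⟩
  have hA0 : 0 ≤ A := (norm_nonneg _).trans (hA' 0)
  have hB0 : 0 ≤ B := (norm_nonneg _).trans (hB' 0)
  have hr : ∀ k : ℤ, ‖qPochInv Q k‖ ≤ B := by
    intro k
    unfold qPochInv
    split_ifs
    · exact hB' _
    · simpa using hB0
  refine ⟨A * (B * B), fun N n => ?_⟩
  rw [tripleCoeff, norm_mul, norm_mul]
  gcongr
  · exact hA' _
  · exact hr _
  · exact hr _

/-- The **Jacobi triple product** identity. -/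
theorem tsum_eq_triple_product {p z : ℂ} (hp : ‖p‖ < 1) (hp0 : p ≠ 0) (hz : z ≠ 0)
    (hs : Summable fun n : ℤ => p ^ (n ^ 2) * z ^ n) :
    ∑' n : ℤ, p ^ (n ^ 2) * z ^ n = (∏' m : ℕ, (1 - (p ^ 2) ^ (m + 1))) *
      ((∏' m : ℕ, (1 + z * p ^ (2 * m + 1))) * ∏' m : ℕ, (1 + z⁻¹ * p ^ (2 * m + 1))) := by
  have hQ : ‖p ^ 2‖ < 1 := by
    rw [norm_pow]; exact pow_lt_one₀ (norm_nonneg _) hp (by norm_num)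
  have hinj : Function.Injective fun m : ℕ => 2 * m + 1 := fun a b h => by simpa using h
  obtain ⟨C, hC⟩ := exists_norm_tripleCoeff_le hQ
  have hl : Tendsto (fun N : ℕ => ∑' n : ℤ, tripleCoeff (p ^ 2) N n * (p ^ (n ^ 2) * z ^ n)) atTop
      (𝓝 (∑' n : ℤ, (∏' m : ℕ, (1 - (p ^ 2) ^ (m + 1)))⁻¹ * (p ^ (n ^ 2) * z ^ n))) := by
    refine tendsto_tsum_of_dominated_convergence (hs.norm.mul_left C)
      (fun n => (tendsto_tripleCoeff hQ n).mul_const _) (.of_forall fun N n => ?_)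
    rw [norm_mul]
    exact mul_le_mul_of_nonneg_right (hC N n) (norm_nonneg _)
  have hr := (multipliable_one_add_mul_pow hp z hinj).tendsto_prod_tprod_nat.mul
    (multipliable_one_add_mul_pow hp z⁻¹ hinj).tendsto_prod_tprod_nat
  have := tendsto_nhds_unique (hl.congr fun N => by
    rw [(hasSum_tripleCoeff hp hp0 hz N).tsum_eq, prod_mul_distrib]; simp only [mul_comm]) hr
  rw [← this, tsum_mul_left, mul_inv_cancel_left₀ (tprod_one_sub_pow_ne_zero hQ)]

/-- **Euler**: `∏ (1 + Q ^ n) ∏ (1 - Q ^ (2 n - 1)) = 1`. -/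
lemma tprod_one_add_mul_tprod_one_sub_odd {Q : ℂ} (hQ : ‖Q‖ < 1) :
    (∏' m : ℕ, (1 + Q ^ (m + 1))) * ∏' m : ℕ, (1 - Q ^ (2 * m + 1)) = 1 := by
  have h0 := tprod_one_sub_pow_ne_zero hQ
  have i1 : Function.Injective fun m : ℕ => m + 1 := fun a b h => by simpa using h
  have i2 : Function.Injective fun m : ℕ => 2 * m + 1 := fun a b h => by simpa using h
  have i3 : Function.Injective fun m : ℕ => 2 * m + 1 + 1 := fun a b h => by simpa using h
  have m1 : Multipliable fun m : ℕ => 1 + Q ^ (m + 1) := by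
    simpa using multipliable_one_add_mul_pow hQ 1 i1
  have m2 : Multipliable fun m : ℕ => 1 - Q ^ (2 * m + 1) := by
    simpa [sub_eq_add_neg] using multipliable_one_add_mul_pow hQ (-1) i2
  have m3 : Multipliable fun m : ℕ => 1 - Q ^ (2 * m + 1 + 1) := by
    simpa [sub_eq_add_neg] using multipliable_one_add_mul_pow hQ (-1) i3
  have e := tprod_even_mul_odd (f := fun m : ℕ => 1 - Q ^ (m + 1)) m2 m3
  -- The factors with even exponent split as `1 - Q ^ (2k) = (1 + Q ^ k) (1 - Q ^ k)`.
  have e' : ∏' m : ℕ, (1 - Q ^ (2 * m + 1 + 1)) =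
      (∏' m : ℕ, (1 + Q ^ (m + 1))) * ∏' m : ℕ, (1 - Q ^ (m + 1)) := by
    rw [← m1.tprod_mul (ModularForm.multipliable_one_sub_pow hQ)]
    exact tprod_congr fun m => by ring
  rw [e'] at e
  apply mul_right_cancel₀ h0
  linear_combination e

end JTheta

end

/-! ### Theta functions as specialisations of the triple product. -/

noncomputable section

namespace JTheta

open Complex Filter Topology Finset

open UpperHalfPlane hiding I

lemma qPow_add (τ : ℍ) (r s : ℝ) : qPow τ (r + s) = qPow τ r * qPow τ s := by
  simp only [qPow, ← Complex.exp_add]; congr 1; push_cast; ring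

lemma qPow_ne_zero (τ : ℍ) (r : ℝ) : qPow τ r ≠ 0 := Complex.exp_ne_zero _

/-- The nome `q ^ (1 / 2) = exp (π i τ)`. -/
def nome (τ : ℍ) : ℂ := qPow τ (1 / 2)

lemma nome_ne_zero (τ : ℍ) : nome τ ≠ 0 := qPow_ne_zero _ _

lemma norm_qPow (τ : ℍ) (r : ℝ) : ‖qPow τ r‖ = Real.exp (-(2 * Real.pi * r * τ.im)) := by
  rw [qPow, Complex.norm_exp]
  congr 1
  simp

lemma norm_nome_lt_one (τ : ℍ) : ‖nome τ‖ < 1 := by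
  rw [nome, norm_qPow, Real.exp_lt_one_iff]
  have := τ.im_pos
  have := Real.pi_pos
  have : 0 < Real.pi * τ.im := by positivity
  linarith

lemma nome_zpow (τ : ℍ) (n : ℤ) : nome τ ^ n = qPow τ (n / 2) := by
  rw [nome, qPow, qPow, ← Complex.exp_int_mul]; congr 1; push_cast; ring

lemma nome_pow (τ : ℍ) (n : ℕ) : nome τ ^ n = qPow τ (n / 2) := by
  rw [← zpow_natCast, nome_zpow, Int.cast_natCast]

lemma jacobiTheta₂_term_eq (τ : ℍ) (w : ℂ) (n : ℤ) :
    jacobiTheta₂_term n w τ = nome τ ^ (n ^ 2) * cexp (2 * Real.pi * I * w) ^ n := by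
  rw [nome_zpow, qPow, jacobiTheta₂_term, ← Complex.exp_int_mul, ← Complex.exp_add]
  congr 1; push_cast; ring

lemma cexp_half : cexp (2 * Real.pi * I * (1 / 2)) = -1 := by
  rw [← Complex.exp_pi_mul_I]; congr 1; ring

lemma cexp_half_tau (τ : ℍ) : cexp (2 * Real.pi * I * (τ / 2)) = nome τ := by
  rw [nome, qPow]; congr 1; push_cast; ring

lemma theta3Term_eq (τ : ℍ) : theta3Term τ = fun n => jacobiTheta₂_term n 0 τ := by
  funext n
  rw [jacobiTheta₂_term_eq, nome_zpow, theta3Term]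
  simp

lemma theta0Term_eq (τ : ℍ) : theta0Term τ = fun n => jacobiTheta₂_term n (1 / 2) τ := by
  funext n
  rw [jacobiTheta₂_term_eq, nome_zpow, theta0Term, cexp_half, mul_comm]
  simp

lemma theta2Term_eq (τ : ℍ) :
    theta2Term τ = fun n => qPow τ (1 / 8) * jacobiTheta₂_term n (τ / 2) τ := by
  funext n
  rw [jacobiTheta₂_term_eq, cexp_half_tau, nome_zpow, nome_zpow, theta2Term, ← qPow_add,
    ← qPow_add]
  congr 1; push_cast; ring

lemma summable_jacobiTheta₂_term (τ : ℍ) (w : ℂ) : Summable fun n => jacobiTheta₂_term n w τ :=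
  (summable_jacobiTheta₂_term_iff _ _).mpr τ.im_pos

lemma summable_theta3Term (τ : ℍ) : Summable (theta3Term τ) := by
  rw [theta3Term_eq]; exact summable_jacobiTheta₂_term τ _

lemma summable_theta0Term (τ : ℍ) : Summable (theta0Term τ) := by
  rw [theta0Term_eq]; exact summable_jacobiTheta₂_term τ _

lemma summable_theta2Term (τ : ℍ) : Summable (theta2Term τ) := by
  rw [theta2Term_eq]; exact (summable_jacobiTheta₂_term τ _).mul_left _

lemma theta3_eq (τ : ℍ) : theta3 τ = jacobiTheta₂ 0 τ := by
  rw [theta3, theta3Term_eq, jacobiTheta₂]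

lemma theta0_eq (τ : ℍ) : theta0 τ = jacobiTheta₂ (1 / 2) τ := by
  rw [theta0, theta0Term_eq, jacobiTheta₂]

lemma theta2_eq (τ : ℍ) : theta2 τ = qPow τ (1 / 8) * jacobiTheta₂ (τ / 2) τ := by
  rw [theta2, theta2Term_eq, tsum_mul_left, jacobiTheta₂]

/-- The triple product for the two-variable Jacobi theta function. -/
theorem jacobiTheta₂_eq_triple_product (τ : ℍ) {w z : ℂ} (hz : cexp (2 * Real.pi * I * w) = z) :
    jacobiTheta₂ w τ = (∏' m : ℕ, (1 - (nome τ ^ 2) ^ (m + 1))) *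
      ((∏' m : ℕ, (1 + z * nome τ ^ (2 * m + 1))) *
        ∏' m : ℕ, (1 + z⁻¹ * nome τ ^ (2 * m + 1))) := by
  have hs := summable_jacobiTheta₂_term τ w
  simp only [jacobiTheta₂_term_eq, hz] at hs
  rw [← tsum_eq_triple_product (norm_nome_lt_one τ) (nome_ne_zero τ)
    (hz ▸ Complex.exp_ne_zero _) hs, jacobiTheta₂]
  exact tsum_congr fun n => by rw [jacobiTheta₂_term_eq, hz]

lemma norm_nome_sq_lt_one (τ : ℍ) : ‖nome τ ^ 2‖ < 1 := by
  rw [norm_pow]; exact pow_lt_one₀ (norm_nonneg _) (norm_nome_lt_one τ) (by norm_num)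

lemma qPow_nat_add_one (τ : ℍ) (n : ℕ) : qPow τ ((n : ℝ) + 1) = (nome τ ^ 2) ^ (n + 1) := by
  rw [← pow_mul, nome_pow]; congr 1; push_cast; ring

lemma qPow_nat_add_half (τ : ℍ) (n : ℕ) :
    qPow τ ((n : ℝ) + 1 - 1 / 2) = nome τ ^ (2 * n + 1) := by
  rw [nome_pow]; congr 1; push_cast; ring

lemma injective_two_mul_add_one : Function.Injective fun m : ℕ => 2 * m + 1 :=
  fun a b h => by simpa using h

lemma hasProd_one_sub (τ : ℍ) : HasProd (fun n : ℕ => 1 - qPow τ ((n : ℝ) + 1))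
    (∏' m : ℕ, (1 - (nome τ ^ 2) ^ (m + 1))) := by
  simp only [qPow_nat_add_one]
  exact (ModularForm.multipliable_one_sub_pow (norm_nome_sq_lt_one τ)).hasProd

lemma hasProd_one_add (τ : ℍ) : HasProd (fun n : ℕ => 1 + qPow τ ((n : ℝ) + 1))
    (∏' m : ℕ, (1 + (nome τ ^ 2) ^ (m + 1))) := by
  simp only [qPow_nat_add_one]
  simpa using (multipliable_one_add_mul_pow (norm_nome_sq_lt_one τ) 1
    (f := fun m => m + 1) (fun a b h => by simpa using h)).hasProd

lemma hasProd_theta3Factor (τ : ℍ) : HasProd (theta3Factor τ) (theta3 τ) := by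
  have h := (multipliable_one_add_mul_pow (norm_nome_lt_one τ) 1
    injective_two_mul_add_one).hasProd
  rw [theta3_eq, jacobiTheta₂_eq_triple_product τ (z := 1) (by simp), inv_one]
  convert! (hasProd_one_sub τ).mul (h.mul h) using 2 with n
  rw [theta3Factor, qPow_nat_add_half, one_mul, sq]

lemma hasProd_theta0Factor (τ : ℍ) : HasProd (theta0Factor τ) (theta0 τ) := by
  have h := (multipliable_one_add_mul_pow (norm_nome_lt_one τ) (-1)
    injective_two_mul_add_one).hasProd
  rw [theta0_eq, jacobiTheta₂_eq_triple_product τ cexp_half, inv_neg_one]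
  convert! (hasProd_one_sub τ).mul (h.mul h) using 2 with n
  rw [theta0Factor, qPow_nat_add_half]
  ring

lemma theta2_eq_mul (τ : ℍ) : theta2 τ = 2 * qPow τ (1 / 8) *
    ((∏' m : ℕ, (1 - (nome τ ^ 2) ^ (m + 1))) * (∏' m : ℕ, (1 + (nome τ ^ 2) ^ (m + 1))) ^ 2) := by
  rw [theta2_eq, jacobiTheta₂_eq_triple_product τ (cexp_half_tau τ)]
  have h1 : ∏' m : ℕ, (1 + nome τ * nome τ ^ (2 * m + 1)) =
      ∏' m : ℕ, (1 + (nome τ ^ 2) ^ (m + 1)) := tprod_congr fun m => by ring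
  -- Here the exponents are shifted down to start at `0`; the factor at `m = 0` is the leading `2`.
  have h2 : ∏' m : ℕ, (1 + (nome τ)⁻¹ * nome τ ^ (2 * m + 1)) =
      2 * ∏' m : ℕ, (1 + (nome τ ^ 2) ^ (m + 1)) := by
    have e : ∀ m : ℕ, 1 + (nome τ)⁻¹ * nome τ ^ (2 * m + 1) = 1 + (nome τ ^ 2) ^ m := fun m => by
      rw [pow_succ, ← pow_mul]; field_simp [nome_ne_zero τ]
    have hm : Multipliable fun m : ℕ => 1 + (nome τ ^ 2) ^ (m + 1) := by
      simpa using multipliable_one_add_mul_pow (norm_nome_sq_lt_one τ) 1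
        (f := fun m => m + 1) (fun a b h => by simpa using h)
    rw [tprod_congr e, tprod_eq_zero_mul' (f := fun m : ℕ => 1 + (nome τ ^ 2) ^ m) hm, pow_zero]
    norm_num
  rw [h1, h2]
  ring

lemma hasProd_theta2Factor (τ : ℍ) : HasProd (theta2Factor τ)
    ((∏' m : ℕ, (1 - (nome τ ^ 2) ^ (m + 1))) * (∏' m : ℕ, (1 + (nome τ ^ 2) ^ (m + 1))) ^ 2) := by
  rw [sq (∏' m : ℕ, (1 + (nome τ ^ 2) ^ (m + 1)))]
  convert! (hasProd_one_sub τ).mul ((hasProd_one_add τ).mul (hasProd_one_add τ)) using 2 with n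
  rw [theta2Factor, sq]

/-- `η ^ 3 = θ₀ θ₂ θ₃ / 2`. -/
lemma theta_mul_eq_eta (τ : ℍ) :
    theta0 τ * theta2 τ * theta3 τ = 2 * ModularForm.eta τ ^ 3 := by
  have hp := norm_nome_lt_one τ
  have hE : ModularForm.eta τ = qPow τ (1 / 24) * ∏' m : ℕ, (1 - (nome τ ^ 2) ^ (m + 1)) := by
    rw [ModularForm.eta]
    congr 1
    · rw [Function.Periodic.qParam, qPow]; congr 1; push_cast; ring
    · refine tprod_congr fun n => ?_
      rw [ModularForm.eta_q_eq_cexp, ← qPow_nat_add_one, qPow]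
      push_cast; rfl
  have h8 : qPow τ (1 / 8) = qPow τ (1 / 24) ^ 3 := by
    rw [pow_succ, sq, ← qPow_add, ← qPow_add]; norm_num
  have hm1 := multipliable_one_add_mul_pow hp 1 injective_two_mul_add_one
  have hm2 := multipliable_one_add_mul_pow hp (-1) injective_two_mul_add_one
  have h4 : (∏' m : ℕ, (1 + 1 * nome τ ^ (2 * m + 1))) *
      ∏' m : ℕ, (1 + -1 * nome τ ^ (2 * m + 1)) =
      ∏' m : ℕ, (1 - (nome τ ^ 2) ^ (2 * m + 1)) := by
    rw [← hm1.tprod_mul hm2]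
    exact tprod_congr fun m => by ring
  have h5 := tprod_one_add_mul_tprod_one_sub_odd (norm_nome_sq_lt_one τ)
  rw [← h4] at h5
  rw [theta2_eq_mul, hE, h8, theta0_eq, theta3_eq, jacobiTheta₂_eq_triple_product τ cexp_half,
    jacobiTheta₂_eq_triple_product τ (z := 1) (w := 0) (by simp), inv_neg_one, inv_one]
  generalize (∏' m : ℕ, (1 + 1 * nome τ ^ (2 * m + 1))) = a at *
  generalize (∏' m : ℕ, (1 + -1 * nome τ ^ (2 * m + 1))) = b at *
  generalize (∏' m : ℕ, (1 + (nome τ ^ 2) ^ (m + 1))) = c at *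
  generalize (∏' m : ℕ, (1 - (nome τ ^ 2) ^ (m + 1))) = d at *
  -- The thetas contribute `(a b c) ^ 2`, and `h5` says `c (a b) = 1`; hence the difference of
  -- squares.
  linear_combination (2 * d ^ 3 * qPow τ (1 / 24) ^ 3) * (c * (a * b) + 1) * h5

lemma theta_ne_zero (τ : ℍ) : theta0 τ ≠ 0 ∧ theta2 τ ≠ 0 ∧ theta3 τ ≠ 0 := by
  have h : theta0 τ * theta2 τ * theta3 τ ≠ 0 := by
    rw [theta_mul_eq_eta]
    exact mul_ne_zero two_ne_zero (pow_ne_zero _ (ModularForm.eta_ne_zero τ.im_pos))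
  exact ⟨fun h0 => h (by simp [h0]), fun h0 => h (by simp [h0]), fun h0 => h (by simp [h0])⟩

end JTheta

end

/-! ### Level one forms of small weight and the action of `S` and `T` on the thetas. -/

noncomputable section

namespace JTheta

open Complex Filter Topology ModularForm

open UpperHalfPlane hiding I

open scoped MatrixGroups Manifold

lemma denom_T (τ : ℍ) : denom ModularGroup.T τ = 1 := by
  rw [ModularGroup.denom_apply]
  simp [ModularGroup.T]

/-- A holomorphic function on the upper half-plane that is invariant in weight `k < 12` and
vanishes at infinity is zero. -/
lemma eq_zero_of_invariant {f : ℍ → ℂ} {k : ℤ} (hk : k < 12) (hf : MDiff f)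
    (hS : ∀ τ, f (ModularGroup.S • τ) = (τ : ℂ) ^ k * f τ)
    (hT : ∀ τ, f (ModularGroup.T • τ) = f τ) (h0 : Tendsto f atImInfty (𝓝 0)) : f = 0 := by
  have hS' : f ∣[k] ModularGroup.S = f := by
    funext τ
    rw [SL_slash_apply, hS]
    rw [ModularGroup.denom_S, mul_comm, ← mul_assoc, ← zpow_add₀ τ.ne_zero]
    simp
  have hT' : f ∣[k] ModularGroup.T = f := by
    funext τ
    rw [SL_slash_apply, hT]
    rw [denom_T]
    simp
  have hinv := SlashInvariantForm.slash_action_generators_SL2Z hS' hT'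
  let F : CuspForm 𝒮ℒ k :=
    { toFun := f
      slash_action_eq' := fun _ ⟨γ, hγ⟩ => hγ ▸ hinv γ
      holo' := hf
      zero_at_cusps' := fun {c} hc => by
        rw [Subgroup.IsArithmetic.isCusp_iff_isCusp_SL2Z] at hc
        rw [OnePoint.isZeroAt_iff_forall_SL2Z hc]
        intro γ _
        -- Full level invariance reduces vanishing at every cusp to vanishing at `i ∞`.
        rw [hinv γ]
        exact h0 }
  have hF : F = 0 := rank_zero_iff_forall_zero.mp (CuspForm.rank_eq_zero_of_weight_lt_twelve hk) F
  funext τ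
  exact congrArg (fun G : CuspForm 𝒮ℒ k => G τ) hF

/-- Since `n ^ 2` and `n` have the same parity, `exp (π i n ^ 2) = exp (π i n)`. -/
lemma jacobiTheta₂_add_one_right (z τ : ℂ) :
    jacobiTheta₂ z (τ + 1) = jacobiTheta₂ (z + 1 / 2) τ := by
  refine tsum_congr fun n => ?_
  simp only [jacobiTheta₂_term]
  obtain ⟨m, hm⟩ := Int.even_mul_succ_self n
  rw [Complex.exp_eq_exp_iff_exists_int]
  refine ⟨m - n, ?_⟩
  have hm' : (n : ℂ) * (n + 1) = m + m := by exact_mod_cast hm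
  push_cast
  linear_combination Real.pi * I * hm'

lemma coe_T_smul (τ : ℍ) : ((ModularGroup.T • τ : ℍ) : ℂ) = τ + 1 := by
  rw [modular_T_smul, coe_vadd]; push_cast; ring

lemma coe_S_smul (τ : ℍ) : ((ModularGroup.S • τ : ℍ) : ℂ) = -1 / τ := by
  rw [modular_S_smul, coe_mk, inv_neg, neg_div, one_div]

lemma theta3_T_smul (τ : ℍ) : theta3 (ModularGroup.T • τ) = theta0 τ := by
  rw [theta3_eq, theta0_eq, coe_T_smul, jacobiTheta₂_add_one_right, zero_add]

lemma theta0_T_smul (τ : ℍ) : theta0 (ModularGroup.T • τ) = theta3 τ := by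
  rw [theta3_eq, theta0_eq, coe_T_smul, jacobiTheta₂_add_one_right, add_halves, ← zero_add (1 : ℂ),
    jacobiTheta₂_add_left]

/-- `T` multiplies `q ^ (1 / 8)` by `exp (π i / 4)`, whose fourth power is `-1`. -/
lemma theta2_T_smul (τ : ℍ) : theta2 (ModularGroup.T • τ) ^ 4 = -theta2 τ ^ 4 := by
  have h : ((τ : ℂ) + 1) / 2 + 1 / 2 = τ / 2 + 1 := by ring
  have h8 : qPow (ModularGroup.T • τ) (1 / 8) ^ 4 = -qPow τ (1 / 8) ^ 4 := by
    rw [qPow, qPow, coe_T_smul, ← Complex.exp_nat_mul, ← Complex.exp_nat_mul,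
      neg_eq_neg_one_mul, ← Complex.exp_pi_mul_I, ← Complex.exp_add]
    congr 1; push_cast; ring
  rw [theta2_eq, theta2_eq, coe_T_smul, jacobiTheta₂_add_one_right, h, jacobiTheta₂_add_left,
    mul_pow, mul_pow, h8, neg_mul]

/-- Fourth powers remove the square root, and with it the choice of branch, from the functional
equation. -/
lemma weight_factor (τ : ℍ) : (-I * (τ : ℂ)) ≠ 0 ∧
    ((-I * (τ : ℂ)) ^ (1 / 2 : ℂ)) ^ 4 = -(τ : ℂ) ^ 2 := by
  have h0 : -I * (τ : ℂ) ≠ 0 := mul_ne_zero (neg_ne_zero.mpr I_ne_zero) τ.ne_zero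
  refine ⟨h0, ?_⟩
  rw [← Complex.cpow_nat_mul]
  norm_num
  rw [mul_pow, I_sq]
  ring

lemma pow_four_of_eq_div {τ : ℍ} {a b : ℂ}
    (h : a = 1 / (-I * (τ : ℂ)) ^ (1 / 2 : ℂ) * b) : b ^ 4 = -(τ : ℂ) ^ 2 * a ^ 4 := by
  obtain ⟨h0, h4⟩ := weight_factor τ
  have hc : (-I * (τ : ℂ)) ^ (1 / 2 : ℂ) ≠ 0 := by
    rw [Ne, cpow_eq_zero_iff, not_and_or]; exact Or.inl h0
  rw [h, ← h4]
  generalize (-I * (τ : ℂ)) ^ (1 / 2 : ℂ) = c at hc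
  field_simp

lemma theta3_S_smul (τ : ℍ) :
    theta3 (ModularGroup.S • τ) ^ 4 = -(τ : ℂ) ^ 2 * theta3 τ ^ 4 := by
  apply pow_four_of_eq_div
  rw [theta3_eq, theta3_eq, jacobiTheta₂_functional_equation, coe_S_smul]
  simp

lemma theta0_S_smul (τ : ℍ) :
    theta0 (ModularGroup.S • τ) ^ 4 = -(τ : ℂ) ^ 2 * theta2 τ ^ 4 := by
  apply pow_four_of_eq_div
  have hτ := τ.ne_zero
  rw [theta0_eq, theta2_eq, jacobiTheta₂_functional_equation, coe_S_smul,
    show (τ : ℂ) / 2 / τ = 1 / 2 by field_simp]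
  -- The Gaussian factor of the functional equation at `w = τ / 2` is exactly `q ^ (-1 / 8)`.
  have : qPow τ (1 / 8) * cexp (-Real.pi * I * (τ / 2) ^ 2 / τ) = 1 := by
    rw [qPow, ← Complex.exp_add, Complex.exp_eq_one_iff]
    refine ⟨0, ?_⟩
    push_cast; field_simp; ring
  linear_combination (1 / (-I * (τ : ℂ)) ^ (1 / 2 : ℂ) * jacobiTheta₂ (1 / 2) (-1 / τ)) * this

lemma theta2_S_smul (τ : ℍ) :
    theta2 (ModularGroup.S • τ) ^ 4 = -(τ : ℂ) ^ 2 * theta0 τ ^ 4 := by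
  apply pow_four_of_eq_div
  have hτ := τ.ne_zero
  rw [theta0_eq, theta2_eq, jacobiTheta₂_functional_equation, coe_S_smul,
    show (1 / 2 / τ : ℂ) = -(-1 / τ / 2) by field_simp, jacobiTheta₂_neg_left, mul_assoc]
  congr 2
  rw [qPow, coe_S_smul]
  congr 1
  push_cast; field_simp; ring

/-! ### Holomorphy of the thetas and their limits at `i ∞`. -/

lemma mdifferentiable_of_differentiableAt {f : ℍ → ℂ} (g : ℂ → ℂ) (h : ∀ τ : ℍ, f τ = g τ)
    (hg : ∀ z : ℂ, 0 < z.im → DifferentiableAt ℂ g z) : MDiff f := by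
  rw [UpperHalfPlane.mdifferentiable_iff]
  intro z hz
  refine ((hg z hz).congr_of_eventuallyEq ?_).differentiableWithinAt
  filter_upwards [isOpen_upperHalfPlaneSet.mem_nhds hz] with w hw
  rw [Function.comp_apply, h, ofComplex_apply_of_im_pos hw]

lemma mdifferentiable_theta3 : MDiff theta3 :=
  mdifferentiable_of_differentiableAt (jacobiTheta₂ 0) theta3_eq
    fun _ hz => differentiableAt_jacobiTheta₂_snd 0 hz

lemma mdifferentiable_theta0 : MDiff theta0 :=
  mdifferentiable_of_differentiableAt (jacobiTheta₂ (1 / 2)) theta0_eq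
    fun _ hz => differentiableAt_jacobiTheta₂_snd _ hz

lemma mdifferentiable_theta2 : MDiff theta2 := by
  refine mdifferentiable_of_differentiableAt
    (fun z => cexp (2 * Real.pi * I * (1 / 8 : ℝ) * z) * jacobiTheta₂ (z / 2) z) theta2_eq
    fun z hz => DifferentiableAt.mul (by fun_prop) ?_
  exact DifferentiableAt.comp (g := fun p : ℂ × ℂ => jacobiTheta₂ p.1 p.2)
    (f := fun z : ℂ => (z / 2, z)) z (hasFDerivAt_jacobiTheta₂ (z / 2) hz).differentiableAt
    (by fun_prop)

/-- Termwise passage to the limit `i ∞` in a series of powers of `q`. -/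
lemma tendsto_tsum_qPow {t : ℍ → ℤ → ℂ} {r : ℤ → ℝ} (hr : ∀ n, 0 ≤ r n)
    (ht : ∀ τ n, ‖t τ n‖ = Real.exp (-(2 * Real.pi * r n * τ.im)))
    (hs : Summable (t UpperHalfPlane.I)) {g : ℤ → ℂ}
    (hg : ∀ n, Tendsto (fun τ => t τ n) atImInfty (𝓝 (g n))) :
    Tendsto (fun τ => ∑' n, t τ n) atImInfty (𝓝 (∑' n, g n)) := by
  refine tendsto_tsum_of_dominated_convergence hs.norm hg ?_
  -- For `Im τ ≥ 1` each term is dominated by its value at `τ = i`.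
  have h1 : ∀ᶠ τ : ℍ in atImInfty, 1 ≤ τ.im :=
    tendsto_comap.eventually (eventually_ge_atTop (1 : ℝ))
  filter_upwards [h1] with τ hτ n
  rw [ht, ht, Real.exp_le_exp, neg_le_neg_iff]
  have : 0 ≤ 2 * Real.pi * r n := mul_nonneg (by positivity) (hr n)
  apply mul_le_mul_of_nonneg_left _ this
  simpa using hτ

lemma tendsto_qPow {r : ℝ} (hr : 0 < r) : Tendsto (fun τ => qPow τ r) atImInfty (𝓝 0) := by
  rw [tendsto_zero_iff_norm_tendsto_zero]
  simp only [norm_qPow]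
  refine Real.tendsto_exp_atBot.comp (tendsto_neg_atTop_atBot.comp ?_)
  exact tendsto_comap.const_mul_atTop (by positivity)

lemma tendsto_theta2 : Tendsto theta2 atImInfty (𝓝 0) := by
  have := tendsto_tsum_qPow (t := theta2Term) (r := fun n => 1 / 2 * ((n : ℝ) + 1 / 2) ^ 2)
    (fun n => by positivity) (fun τ n => norm_qPow _ _) (summable_theta2Term _) (g := 0) fun n => by
      refine tendsto_qPow ?_
      have : (n : ℝ) + 1 / 2 ≠ 0 := by
        intro h
        have h2 : (2 * n + 1 : ℝ) = 0 := by linarith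
        have h3 : 2 * n + 1 = 0 := by exact_mod_cast h2
        omega
      positivity
  simpa [show theta2 = fun τ => ∑' n, theta2Term τ n from rfl] using this

lemma tendsto_theta3 : Tendsto theta3 atImInfty (𝓝 1) := by
  have := tendsto_tsum_qPow (t := theta3Term) (r := fun n => (n : ℝ) ^ 2 / 2)
    (fun n => by positivity) (fun τ n => norm_qPow _ _) (summable_theta3Term _)
    (g := fun n => if n = 0 then 1 else 0) fun n => by
      split_ifs with h
      · simp [h, theta3Term, qPow]
      · exact tendsto_qPow (by positivity)
  simpa [show theta3 = fun τ => ∑' n, theta3Term τ n from rfl] using this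

lemma tendsto_theta0 : Tendsto theta0 atImInfty (𝓝 1) := by
  have := tendsto_tsum_qPow (t := theta0Term) (r := fun n => (n : ℝ) ^ 2 / 2)
    (fun n => by positivity) (fun τ n => by simp [theta0Term, norm_qPow]) (summable_theta0Term _)
    (g := fun n => if n = 0 then 1 else 0) fun n => by
      split_ifs with h
      · simp [h, theta0Term, qPow]
      · simpa [theta0Term] using (tendsto_qPow (r := (n : ℝ) ^ 2 / 2) (by positivity)).const_mul
          ((-1 : ℂ) ^ n)
  simpa [show theta0 = fun τ => ∑' n, theta0Term τ n from rfl] using this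

/-! ### The quartic identity, `E₄`, and the formula for `j`. -/

/-- Jacobi's quartic identity. -/
theorem theta3_pow_four (τ : ℍ) : theta3 τ ^ 4 = theta0 τ ^ 4 + theta2 τ ^ 4 := by
  -- The difference itself changes sign under `T` and picks up `-τ ^ 2` under `S`; its square is
  -- invariant of weight 4.
  have h := eq_zero_of_invariant (k := 4)
    (f := (theta3 ^ 4 - theta0 ^ 4 - theta2 ^ 4) ^ 2) (by norm_num)
    (((mdifferentiable_theta3.pow 4).sub (mdifferentiable_theta0.pow 4)).sub
      (mdifferentiable_theta2.pow 4) |>.pow 2)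
    (fun τ => by
      simp only [Pi.pow_apply, Pi.sub_apply, theta3_S_smul, theta0_S_smul, theta2_S_smul]
      norm_cast
      ring)
    (fun τ => by
      simp only [Pi.pow_apply, Pi.sub_apply, theta3_T_smul, theta0_T_smul, theta2_T_smul]
      ring)
    (by
      have := (((tendsto_theta3.pow 4).sub (tendsto_theta0.pow 4)).sub (tendsto_theta2.pow 4)).pow 2
      norm_num at this
      exact this)
  have h2 := congrFun h τ
  simp only [Pi.pow_apply, Pi.sub_apply, Pi.zero_apply] at h2
  have h3 := pow_eq_zero_iff (two_ne_zero) |>.mp h2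
  linear_combination h3

lemma E4_eq (τ : ℍ) : E4 τ = ModularForm.E₄ τ := by
  have h := EisensteinSeries.q_expansion_bernoulli (k := 4) (by norm_num) ⟨2, rfl⟩ τ
  rw [h, E4, show bernoulli 4 = -1 / 30 by decide +kernel]
  have : ∀ n : ℕ+, qPow τ ((n : ℕ) : ℝ) = cexp (2 * Real.pi * I * τ) ^ ((n : ℕ) : ℤ) := fun n => by
    rw [qPow, ← Complex.exp_int_mul]; congr 1; push_cast; ring
  simp only [this]
  norm_num

lemma E₄_smul (γ : SL(2, ℤ)) (τ : ℍ) :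
    ModularForm.E₄ (γ • τ) = denom γ τ ^ (4 : ℤ) * ModularForm.E₄ τ := by
  have : SlashInvariantFormClass (ModularForm 𝒮ℒ 4) (CongruenceSubgroup.Gamma 1) 4 :=
    CongruenceSubgroup.Gamma_one_coe_eq_SL ▸ inferInstance
  exact SlashInvariantForm.slash_action_eqn_SL'' ModularForm.E₄
    (CongruenceSubgroup.mem_Gamma_one γ) τ

/-- The limit is the value of the cusp function at `0`, which is the constant coefficient of the
`q`-expansion. -/
lemma tendsto_E₄ : Tendsto ModularForm.E₄ atImInfty (𝓝 1) := by
  have hanal := ModularFormClass.analyticAt_cuspFunction_zero ModularForm.E₄ one_pos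
    one_mem_strictPeriods_SL
  have hper := SlashInvariantFormClass.periodic_comp_ofComplex ModularForm.E₄
    one_mem_strictPeriods_SL
  have h1 : cuspFunction 1 ModularForm.E₄ 0 = 1 := by
    rw [cuspFunction_apply_zero one_pos hanal hper, ← qExpansion_coeff_zero one_pos hanal hper]
    exact EisensteinSeries.E_qExpansion_coeff_zero _ ⟨2, rfl⟩
  rw [← h1]
  exact (hanal.continuousAt.tendsto.comp (qParam_tendsto_atImInfty one_pos)).congr
    fun τ => SlashInvariantFormClass.eq_cuspFunction _ τ one_mem_strictPeriods_SL one_ne_zero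

/-- `2 E₄ = θ₀ ^ 8 + θ₂ ^ 8 + θ₃ ^ 8`. -/
theorem two_mul_E4 (τ : ℍ) : 2 * E4 τ = theta0 τ ^ 8 + theta2 τ ^ 8 + theta3 τ ^ 8 := by
  have e8 : ∀ x : ℂ, x ^ 8 = (x ^ 4) ^ 2 := fun x => by ring
  have hE : MDiff (ModularForm.E₄ : ℍ → ℂ) := ModularForm.E₄.holo'
  have h := eq_zero_of_invariant (k := 4)
    (f := theta0 ^ 8 + theta2 ^ 8 + theta3 ^ 8 - (2 : ℂ) • (ModularForm.E₄ : ℍ → ℂ))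
    (by norm_num)
    ((((mdifferentiable_theta0.pow 8).add (mdifferentiable_theta2.pow 8)).add
      (mdifferentiable_theta3.pow 8)).sub (hE.const_smul 2))
    (fun τ => by
      have := E₄_smul ModularGroup.S τ
      rw [ModularGroup.denom_S] at this
      simp only [Pi.pow_apply, Pi.sub_apply, Pi.add_apply, Pi.smul_apply, e8, theta3_S_smul,
        theta0_S_smul, theta2_S_smul, this, smul_eq_mul, zpow_ofNat]
      ring)
    (fun τ => by
      have := E₄_smul ModularGroup.T τ
      rw [denom_T] at this
      simp only [Pi.pow_apply, Pi.sub_apply, Pi.add_apply, Pi.smul_apply, e8, theta3_T_smul,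
        theta0_T_smul, theta2_T_smul, this, one_zpow]
      ring)
    (by
      have := (((tendsto_theta0.pow 8).add (tendsto_theta2.pow 8)).add (tendsto_theta3.pow 8)).sub
        (tendsto_E₄.const_smul (2 : ℂ))
      norm_num at this
      exact this)
  have h2 := congrFun h τ
  simp only [Pi.pow_apply, Pi.sub_apply, Pi.add_apply, Pi.smul_apply, smul_eq_mul,
    Pi.zero_apply] at h2
  rw [E4_eq]
  linear_combination -h2

theorem j_eq (τ : ℍ) : j τ =
    2 ^ 7 * (theta0 τ ^ 8 + theta2 τ ^ 8 + theta3 τ ^ 8) *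
      (theta0 τ ^ (-8 : ℤ) + theta2 τ ^ (-8 : ℤ) + theta3 τ ^ (-8 : ℤ)) := by
  obtain ⟨h0, h2, h3⟩ := theta_ne_zero τ
  have hη24 : (theta0 τ * theta2 τ * theta3 τ) ^ 8 = 256 * ModularForm.eta τ ^ 24 := by
    rw [theta_mul_eq_eta]; ring
  have hE : E4 τ = (theta0 τ ^ 8 + theta2 τ ^ 8 + theta3 τ ^ 8) / 2 := by
    rw [← two_mul_E4]; ring
  have hη' : ModularForm.eta τ ^ 24 = (theta0 τ * theta2 τ * theta3 τ) ^ 8 / 256 := by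
    rw [hη24]; ring
  have e : ∀ x : ℂ, x ^ (-8 : ℤ) = (x ^ 8)⁻¹ := fun x => by
    rw [zpow_neg]; norm_cast
  have h4 := theta3_pow_four τ
  rw [j, hE, hη', e, e, e]
  -- With `x = θ₀ ^ 4`, `y = θ₂ ^ 4` and `θ₃ ^ 4 = x + y`, both sides equal `4 (x ^ 2 + x y + y ^ 2)
  -- ^ 2`.
  have key : (theta0 τ ^ 8 + theta2 τ ^ 8 + theta3 τ ^ 8) ^ 2 =
      4 * (theta2 τ ^ 8 * theta3 τ ^ 8 + theta0 τ ^ 8 * theta3 τ ^ 8 +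
        theta0 τ ^ 8 * theta2 τ ^ 8) := by
    rw [show theta3 τ ^ 8 = (theta0 τ ^ 4 + theta2 τ ^ 4) ^ 2 by rw [← h4]; ring]
    ring
  field_simp
  linear_combination 256 * (theta0 τ ^ 8 + theta2 τ ^ 8 + theta3 τ ^ 8) * key

end JTheta

end

theorem lemma3p1 (τ : UpperHalfPlane) :
    -- the three series converge, and so do the three products, to the values displayed
    (Summable (JTheta.theta0Term τ) ∧ Multipliable (JTheta.theta0Factor τ) ∧
      JTheta.theta0 τ = ∏' n : ℕ, JTheta.theta0Factor τ n) ∧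
    (Summable (JTheta.theta2Term τ) ∧ Multipliable (JTheta.theta2Factor τ) ∧
      JTheta.theta2 τ = 2 * JTheta.qPow τ (1 / 8) * ∏' n : ℕ, JTheta.theta2Factor τ n) ∧
    (Summable (JTheta.theta3Term τ) ∧ Multipliable (JTheta.theta3Factor τ) ∧
      JTheta.theta3 τ = ∏' n : ℕ, JTheta.theta3Factor τ n) ∧
    -- the negative powers below make sense
    (JTheta.theta0 τ ≠ 0 ∧ JTheta.theta2 τ ≠ 0 ∧ JTheta.theta3 τ ≠ 0) ∧
    JTheta.j τ =
      2 ^ 7 * (JTheta.theta0 τ ^ 8 + JTheta.theta2 τ ^ 8 + JTheta.theta3 τ ^ 8) *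
        (JTheta.theta0 τ ^ (-8 : ℤ) + JTheta.theta2 τ ^ (-8 : ℤ) +
          JTheta.theta3 τ ^ (-8 : ℤ)) := by
  refine ⟨⟨JTheta.summable_theta0Term τ, (JTheta.hasProd_theta0Factor τ).multipliable,
    (JTheta.hasProd_theta0Factor τ).tprod_eq.symm⟩,
    ⟨JTheta.summable_theta2Term τ, (JTheta.hasProd_theta2Factor τ).multipliable, ?_⟩,
    ⟨JTheta.summable_theta3Term τ, (JTheta.hasProd_theta3Factor τ).multipliable,
      (JTheta.hasProd_theta3Factor τ).tprod_eq.symm⟩, JTheta.theta_ne_zero τ, JTheta.j_eq τ⟩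
  rw [(JTheta.hasProd_theta2Factor τ).tprod_eq, JTheta.theta2_eq_mul]
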